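/- A *simple stochastic multiplayer game* (SSMG) has a finite set of players and a finite set of vertices. Each vertex is either controlled by one player, and then has a non-empty set of successors, or stochastic, and then has a rational probability distribution on successors. Each player $i$ has a set $F_i$ of terminal vertices (vertices whose only successor is the vertex itself). A strategy of player $i$ maps every history $xv$ (a finite sequence of vertices) ending in a vertex $v$ controlled by $i$ to a probability distribution on the successors of $v$; it is *pure* if it always selects one successor with probability $1$. A pure strategy $\sigma$ is *finite-state* if the equivalence relation "$\sigma(xz)=\sigma(yz)$ for all sequences $z$ ending in a vertex controlled by $i$" on finite sequences $x,y$ of vertices has finitely many classes. A strategy profile (one strategy for each player) and an initial vertex induce a probability measure on infinite plays; the *payoff* of player $i$ is the probability of reaching $F_i$. A profile is a *Nash equilibrium* if no player can increase her own payoff by unilaterally switching to any other (possibly mixed) strategy. A profile is pure, or finite-state, if all its strategies are. **Proposition.** There is an SSMG (with an initial vertex) that has a pure Nash equilibrium in which player $0$ wins almost surely (has payoff $1$), but that has no finite-state Nash equilibrium in which player $0$ wins with positive probability (has payoff $>0$). In fact, the following game has both properties. Its players are $0$, $1$, and $A_j^t,B_j^t$ for $j\in\{1,2\}$, $t\in\{0,1\}$;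 write $\bar t=1-t$, and let $\gamma$ range over the labels $\mathrm{init},\mathrm{inc}(j),\mathrm{dec}(j),\mathrm{zero}(j)$, $j\in\{1,2\}$. * *Initial vertex.* It is controlled by player $1$, who moves either to the first vertex of $S^0_{\mathrm{init}}$ or to a terminal vertex where exactly player $1$ wins. * *Gadget $S^t_\gamma$.* Four vertices, controlled by $A_1^t,B_1^t,A_2^t,B_2^t$ in this order. From each, its controller either goes on to the next vertex (from the fourth, to the vertex $s^t_\gamma$) or leaves; after leaving at a vertex of an $A$-player (a $B$-player), the play ends with probability $\frac13$ (with probability $\frac16$) in a terminal vertex where exactly the eight players $A_{j}^{u},B_{j}^{u}$ win, and otherwise in a terminal vertex where nobody wins. The stochastic vertex $s^t_\gamma$ leads with probability $\frac12$ to $I^t_\gamma$, and with probability $\frac14$ each to $C^t_{1,\gamma}$ and $C^t_{2,\gamma}$. * *Gadget $I^t_\gamma$.* One vertex, controlled by player $0$, whose only successor is the first vertex of $S^{\bar t}_{\mathrm{inc}(1)}$. (This encodes the two-counter machine whose single instruction is "increment counter $1$ and go to instruction $1$".) * *Gadget $C^t_{j,\gamma}$.* It is entered at a vertex $c$ controlled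 by player $0$. From $c$ she can move to a stochastic vertex $d_1$ and, unless $\gamma\in\{\mathrm{init},\mathrm{zero}(j)\}$, also to a stochastic vertex $g$. From $g$ the play returns to $c$ with probability $\frac12$, and with probability $\frac12$ it ends where exactly $0,1,A_j^t,B_j^{\bar t}$ win. From $d_r$ ($r=1,2,3$) it goes with probability $\frac12$ to $d_{r+1}$ (where $d_4$ is a terminal vertex at which exactly $0,1,B_j^t,B_j^{\bar t}$ win) and with probability $\frac12$ to a terminal vertex $e_r$. Exactly $0,1,A_j^t,A_j^{\bar t}$ win at $e_{r^*}$, where $r^*=1$ if $\gamma=\mathrm{inc}(j)$, $r^*=3$ if $\gamma=\mathrm{dec}(j)$, and $r^*=2$ otherwise; exactly $0,1,A_j^t,B_j^{\bar t}$ win at $e_r$ for $r\neq r^*$. -/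

import Mathlib

open MeasureTheory ProbabilityTheory
open scoped ENNReal NNReal

noncomputable section

/-- A simple stochastic multiplayer game with finite player set `P` and finite vertex set `V`.
`owner v = some i` means that `v` is controlled by player `i` and `owner v = none` that `v` is
stochastic. The transitions out of a controlled vertex `v` are the pairs with `move v w`; the
transitions out of a stochastic vertex `v` are labelled by the rational probabilities `prob v w`.
(The values of `move` at stochastic and of `prob` at controlled vertices are not used.) -/
structure SSMG (P V : Type) [Fintype P] [Fintype V] where
  owner : V → Option P
  move : V → V → Prop
  prob : V → V → ℚ≥0
  /-- `win i` is the set of terminal vertices at which player `i` wins. -/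
  win : P → Set V
  move_exists : ∀ v, owner v ≠ none → ∃ w, move v w
  prob_sum : ∀ v, owner v = none → ∑ w, prob v w = 1
  win_terminal : ∀ i, ∀ v ∈ win i, ∀ w,
    ((owner v = none ∧ 0 < prob v w) ∨ (owner v ≠ none ∧ move v w)) ↔ w = v

namespace SSMG

variable {P V : Type} [Fintype P] [Fintype V]

/-- A mixed strategy of player `i`: to a history `x v`, where `v` is controlled by player `i`,
it assigns a probability distribution on the vertices that is supported on the moves from `v`. -/
structure Strategy (G : SSMG P V) (i : P) where
  dist : (x : List V) → (v : V) → G.owner v = some i → PMF V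
  legal : ∀ x v (hv : G.owner v = some i) w, dist x v hv w ≠ 0 → G.move v w

/-- A mixed strategy profile. -/
abbrev Profile (G : SSMG P V) : Type := (i : P) → G.Strategy i

variable {G : SSMG P V}

/-- A strategy is pure if after each history it selects one move with probability `1`. -/
def Strategy.IsPure {i : P} (τ : G.Strategy i) : Prop :=
  ∀ x v (hv : G.owner v = some i), ∃ w, τ.dist x v hv w = 1

/-- The relation `x ∼ y` iff `τ (x z) = τ (y z)` for every `z` that ends in a vertex controlled
by player `i`. -/
def Strategy.histSetoid {i : P} (τ : G.Strategy i) : Setoid (List V) where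
  r x y := ∀ (z : List V) (v : V) (hv : G.owner v = some i),
    τ.dist (x ++ z) v hv = τ.dist (y ++ z) v hv
  iseqv := ⟨fun _ _ _ _ => rfl, fun h z v hv => (h z v hv).symm,
    fun h h' z v hv => (h z v hv).trans (h' z v hv)⟩

/-- A finite-state strategy is a pure strategy whose equivalence relation on histories has only
finitely many classes. -/
def Strategy.IsFiniteState {i : P} (τ : G.Strategy i) : Prop :=
  τ.IsPure ∧ Finite (Quotient τ.histSetoid)

/-- A profile of pure strategies. -/
def IsPureProfile (σ : G.Profile) : Prop := ∀ i, (σ i).IsPure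

/-- A profile of finite-state strategies. -/
def IsFiniteStateProfile (σ : G.Profile) : Prop := ∀ i, (σ i).IsFiniteState

/-- The distribution of the successor of a stochastic vertex. -/
def stochStep (G : SSMG P V) (v : V) (hv : G.owner v = none) : PMF V :=
  PMF.ofFintype (fun w => (((G.prob v w : ℚ≥0) : ℝ≥0) : ℝ≥0∞)) (by
    have h := G.prob_sum v hv
    rw [← ENNReal.ofNNReal_finsetSum, ← NNRat.cast_sum, h]
    simp)

/-- The distribution of the vertex that follows the history `x v` under the profile `σ`. -/
def step (σ : G.Profile) (x : List V) (v : V) : PMF V :=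
  match h : G.owner v with
  | none => G.stochStep v h
  | some i => (σ i).dist x v h

variable [MeasurableSpace V] [DiscreteMeasurableSpace V]

/-- The transition kernel from the first `n + 1` vertices of a play to the next vertex. -/
def stepKernel (σ : G.Profile) (n : ℕ) :
    Kernel ((k : Finset.Iic n) → (fun _ : ℕ => V) k) V :=
  Kernel.ofFunOfCountable fun h =>
    (step σ (List.ofFn fun k : Fin n => h ⟨k, Finset.mem_Iic.2 k.2.le⟩)
      (h ⟨n, Finset.mem_Iic.2 le_rfl⟩)).toMeasure

instance (σ : G.Profile) (n : ℕ) : IsMarkovKernel (stepKernel σ n) :=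
  ⟨fun h => by unfold stepKernel; exact PMF.toMeasure.isProbabilityMeasure _⟩

/-- The probability measure on infinite plays that is induced by the profile `σ` and the initial
vertex `v₀`. -/
def playMeasure (σ : G.Profile) (v₀ : V) : Measure (ℕ → V) :=
  Kernel.traj (X := fun _ : ℕ => V) (stepKernel σ) 0 (fun _ => v₀)

/-- The event that a play visits the set `U`. -/
def reach (U : Set V) : Set (ℕ → V) := {ρ | ∃ n, ρ n ∈ U}

/-- The payoff of the profile `σ` for player `i`. -/
def payoff (σ : G.Profile) (v₀ : V) (i : P) : ℝ≥0∞ := playMeasure σ v₀ (reach (G.win i))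

variable [DecidableEq P]

/-- `τ` is a best response of player `i` to `σ` in the game with initial vertex `v₀`. -/
def IsBestResponse (σ : G.Profile) (v₀ : V) (i : P) (τ : G.Strategy i) : Prop :=
  ∀ τ' : G.Strategy i,
    payoff (Function.update σ i τ') v₀ i ≤ payoff (Function.update σ i τ) v₀ i

/-- `σ` is a Nash equilibrium of the game with initial vertex `v₀`. -/
def IsNash (σ : G.Profile) (v₀ : V) : Prop := ∀ i, IsBestResponse σ v₀ i (σ i)

end SSMG

/-- Instructions of a two-counter machine whose instructions are numbered by `Fin n`; the
counters are numbered by `Fin 2`. -/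
inductive CounterInstr (n : ℕ) : Type
  | inc (j : Fin 2) (k : Fin n)
  | test (j : Fin 2) (k l : Fin n) (hkl : k ≠ l)
  | halt

/-- A two-counter machine, given by a non-empty list of instructions; it starts with
instruction `0`. -/
structure CounterMachine where
  m : ℕ
  instr : Fin (m + 1) → CounterInstr (m + 1)

namespace CounterMachine

/-- The players: player `0`, the extra player `1`, and the players `A_j^t` and `B_j^t`. -/
inductive Player : Type
  | zero
  | one
  | A (j : Fin 2) (t : Bool)
  | B (j : Fin 2) (t : Bool)
  deriving DecidableEq, Fintype

/-- The labels `γ`: the way in which the current instruction was reached. -/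
inductive Label : Type
  | init
  | inc (j : Fin 2)
  | dec (j : Fin 2)
  | zero (j : Fin 2)
  deriving DecidableEq, Fintype

set_option synthInstance.maxSize 2000 in
set_option synthInstance.maxHeartbeats 400000 in
/-- The vertices of the game for a machine with `m + 1` instructions. -/
inductive Vertex (m : ℕ) : Type
  /-- the initial vertex, controlled by player `1` -/
  | start
  /-- the terminal vertex where only player `1` wins -/
  | quit
  /-- terminal vertex where exactly the players `A_j^t` and `B_j^t` win -/
  | allWin
  /-- terminal vertex where nobody wins -/
  | noneWin
  /-- the four controlled vertices of the gadget `S_{i,γ}^t`, from top to bottom -/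
  | sim (i : Fin (m + 1)) (γ : Label) (t : Bool) (r : Fin 4)
  /-- the stochastic vertices that realise the payoffs obtained by leaving `S_{i,γ}^t` -/
  | leave (i : Fin (m + 1)) (γ : Label) (t : Bool) (r : Fin 4)
  /-- the stochastic vertex at the bottom of the gadget `S_{i,γ}^t` -/
  | branch (i : Fin (m + 1)) (γ : Label) (t : Bool)
  /-- the vertex controlled by player `0` in the instruction gadget `I_{i,γ}^t` -/
  | instr (i : Fin (m + 1)) (γ : Label) (t : Bool)
  /-- the vertex controlled by player `0` in the counter gadget `C_{j,γ}^t` -/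
  | ctl (j : Fin 2) (γ : Label) (t : Bool)
  /-- the grey vertex of `C_{j,γ}^t` -/
  | grey (j : Fin 2) (γ : Label) (t : Bool)
  /-- the terminal vertex behind the grey vertex of `C_{j,γ}^t` -/
  | greyEnd (j : Fin 2) (γ : Label) (t : Bool)
  /-- the three stochastic vertices of `C_{j,γ}^t` in a row, from left to right -/
  | row (j : Fin 2) (γ : Label) (t : Bool) (r : Fin 3)
  /-- the terminal vertices above the row of `C_{j,γ}^t` -/
  | rowEnd (j : Fin 2) (γ : Label) (t : Bool) (r : Fin 3)
  /-- the terminal vertex at the right end of the row of `C_{j,γ}^t` -/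
  | last (j : Fin 2) (γ : Label) (t : Bool)
  deriving DecidableEq, Fintype

instance (m : ℕ) : MeasurableSpace (Vertex m) := ⊤

instance (m : ℕ) : DiscreteMeasurableSpace (Vertex m) := ⟨fun _ => trivial⟩

/-- The controller of a vertex; terminal vertices are regarded as stochastic. -/
def owner {m : ℕ} : Vertex m → Option Player
  | .start => some .one
  | .sim _ _ t r => some (![.A 0 t, .B 0 t, .A 1 t, .B 1 t] r)
  | .instr _ _ _ => some .zero
  | .ctl _ _ _ => some .zero
  | _ => none

/-- The successors of the controlled vertices. -/
def next (M : CounterMachine) : Vertex M.m → Set (Vertex M.m)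
  | .start => {.sim 0 .init false 0, .quit}
  | .sim i γ t r =>
      {![.sim i γ t 1, .sim i γ t 2, .sim i γ t 3, .branch i γ t] r, .leave i γ t r}
  | .instr i _ t =>
      match M.instr i with
      | .inc j k => {.sim k (.inc j) (!t) 0}
      | .test j k l _ => {.sim k (.zero j) (!t) 0, .sim l (.dec j) (!t) 0}
      | .halt => {.noneWin}
  | .ctl j γ t =>
      if γ = .init ∨ γ = .zero j then {.row j γ t 0} else {.row j γ t 0, .grey j γ t}
  | _ => ∅

/-- The transition probabilities of the stochastic vertices. -/
def prob {m : ℕ} : Vertex m → Vertex m → ℚ≥0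
  | .leave _ _ _ r =>
      Pi.single .allWin (![1/3, 1/6, 1/3, 1/6] r) + Pi.single .noneWin (![2/3, 5/6, 2/3, 5/6] r)
  | .branch i γ t =>
      Pi.single (.instr i γ t) (1/2) + Pi.single (.ctl 0 γ t) (1/4) + Pi.single (.ctl 1 γ t) (1/4)
  | .grey j γ t => Pi.single (.ctl j γ t) (1/2) + Pi.single (.greyEnd j γ t) (1/2)
  | .row j γ t r =>
      Pi.single (![.row j γ t 1, .row j γ t 2, .last j γ t] r) (1/2) +
        Pi.single (.rowEnd j γ t r) (1/2)
  | v => Pi.single v 1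

/-- The position in the row of `C_{j,γ}^t` of the vertex below the terminal vertex where both
`A_j^0` and `A_j^1` win. -/
def markedPos (j : Fin 2) (γ : Label) : Fin 3 :=
  if γ = .inc j then 0 else if γ = .dec j then 2 else 1

/-- The set of players that win at a vertex. -/
def winners {m : ℕ} : Vertex m → Set Player
  | .quit => {.one}
  | .allWin => {p | p ≠ .zero ∧ p ≠ .one}
  | .greyEnd j _ t => {.zero, .one, .A j t, .B j (!t)}
  | .rowEnd j γ t r =>
      if r = markedPos j γ then {.zero, .one, .A j t, .A j (!t)}
      else {.zero, .one, .A j t, .B j (!t)}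
  | .last j _ t => {.zero, .one, .B j t, .B j (!t)}
  | _ => ∅

/-- The game that simulates the machine `M`, together with the additional initial vertex. -/
def game (M : CounterMachine) : SSMG Player (Vertex M.m) where
  owner := owner
  move v w := w ∈ M.next v
  prob := prob
  win p := {v | p ∈ winners v}
  move_exists := by
    intro v hv
    cases v with
    | start => exact ⟨_, Or.inr rfl⟩
    | sim i γ t r => exact ⟨_, Or.inr rfl⟩
    | instr i γ t =>
      simp only [next]
      cases M.instr i with
      | inc j k => exact ⟨_, rfl⟩
      | test j k l h => exact ⟨_, Or.inl rfl⟩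
      | halt => exact ⟨_, rfl⟩
    | ctl j γ t =>
      refine ⟨.row j γ t 0, ?_⟩
      simp only [next]
      split_ifs <;> simp
    | _ => exact absurd rfl hv
  prob_sum := by
    intro v hv
    cases v with
    | leave i γ t r =>
      fin_cases r <;> simp [prob, Finset.sum_add_distrib] <;> norm_num
    | branch i γ t => simp [prob, Finset.sum_add_distrib]; norm_num
    | grey j γ t => simp [prob, Finset.sum_add_distrib]; norm_num
    | row j γ t r => simp [prob, Finset.sum_add_distrib]; norm_num
    | start => simp [owner] at hv
    | sim i γ t r => simp [owner] at hv
    | instr i γ t => simp [owner] at hv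
    | ctl j γ t => simp [owner] at hv
    | _ => simp [prob]
  win_terminal := by
    intro p v hv w
    cases v <;> first
      | (simp [winners] at hv; done)
      | (simp only [owner, prob, Pi.single_apply]; split_ifs <;> simp_all)

/-- The machine whose only instruction is: increment the first counter and go to instruction
`0`, i.e. to this instruction itself. -/
def incMachine : CounterMachine where
  m := 0
  instr := fun _ => .inc 0 0

end CounterMachine

end

/-!
As long as no `A`- or `B`-player leaves, a play is a sequence of rounds, and each round is followed
by a further one with probability `1/2`. In the counter gadget `C_{j,γ}^t` of a round, let
`q` be the probability that the row is entered. Then `A_j^t` and `B_j^t` get `1 - q/8` and `q/8`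
there, and `A_j^{!t}` gets `2⁻ʳ q`, where `r` is the (one-based) marked position; moreover `A_j^u`
and `B_j^u` together always get `1` there and `0` in the gadget of the other counter
(`rval_ctl_add`, `rval_ctl_A_not`, `rval_ctl_of_ne`). Hence together they get `1/2` in total
(`IsRunning.rval_branch_add`), so neither of them prefers to leave, which would yield `1/3` and
`1/6`, if and only if they get exactly `1/3` and `1/6` in each of their rounds. Expanding the
payoff of `A_j^t` over two rounds (`IsRunning.rval_branch_A`) turns this into the equation
`2⁻ʳ' q' = q / 4` between consecutive rounds. For the first counter, after an increment, this says
`q' = q / 2`.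

In an equilibrium where player `0` wins with positive probability, player `1` does not quit, so she
has the payoff `1` that quitting would yield, so nobody ever leaves (`isRunning_runs`). As the
label `init` forces `q = 1` in the first round, `q = 2⁻ⁿ` in the `n`-th round
(`Runs.counterValue_next`). But `q` depends only on the behaviour of player `0` after the history,
so it takes finitely many values if her strategy is finite-state (`counterValue_congr`).
Conversely, if player `0` visits the grey vertex of the first counter exactly `n` times in the
`n`-th round, and never that of the second one, then leaving never pays off
(`rval_sim_pureProfile`).

The link to the path measure is made once, in `SSMG.payoff_eq_val`: payoffs are values of a
recursion over finite histories. Deviations are handled by the two forms of the one-shot deviation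
principle, `SSMG.isBestResponse_of_val_le` for arbitrary mixed deviations and
`SSMG.IsNash.val_le` for the converse at histories of positive probability.
-/

namespace SSMG

section General

variable {P V : Type} [Fintype P] [Fintype V] {G : SSMG P V}

/-! ### Reachability values of histories -/

/-- The sum of the transition probabilities after a history is `1`. -/
lemma sum_step (σ : G.Profile) (x : List V) (v : V) : ∑ w, step σ x v w = 1 := by
  rw [← tsum_fintype (L := SummationFilter.unconditional V)]
  exact (step σ x v).tsum_coe

open Classical in
/-- The probability that a play which continues the history `x v` under `σ` is in `U` at `v` or
during the next `n` steps. Visits to `U` in `x` do not count. -/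
noncomputable def valN (σ : G.Profile) (U : Set V) : ℕ → List V → V → ℝ≥0∞
  | 0, _, v => if v ∈ U then 1 else 0
  | n + 1, x, v => if v ∈ U then 1 else ∑ w, step σ x v w * valN σ U n (x ++ [v]) w

/-- The probability that a play which continues the history `x v` under `σ` visits `U` at `v` or
later. -/
noncomputable def val (σ : G.Profile) (U : Set V) (x : List V) (v : V) : ℝ≥0∞ :=
  ⨆ n, valN σ U n x v

variable {σ σ' : G.Profile} {U : Set V}

lemma valN_mem {x : List V} {v : V} (hv : v ∈ U) (n : ℕ) : valN σ U n x v = 1 := by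
  cases n <;> simp [valN, hv]

lemma valN_succ {x : List V} {v : V} (hv : v ∉ U) (n : ℕ) :
    valN σ U (n + 1) x v = ∑ w, step σ x v w * valN σ U n (x ++ [v]) w := by
  simp [valN, hv]

lemma valN_le_succ (n : ℕ) : ∀ x v, valN σ U n x v ≤ valN σ U (n + 1) x v := by
  induction n with
  | zero =>
    intro x v
    by_cases hv : v ∈ U
    · simp [valN_mem hv]
    · simp [valN, hv]
  | succ n ih =>
    intro x v
    by_cases hv : v ∈ U
    · simp [valN_mem hv]
    · rw [valN_succ hv, valN_succ hv]
      exact Finset.sum_le_sum fun w _ => mul_le_mul_right (ih _ _) _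

lemma monotone_valN (x : List V) (v : V) : Monotone fun n => valN σ U n x v :=
  monotone_nat_of_le_succ fun n => valN_le_succ n x v

lemma val_mem {x : List V} {v : V} (hv : v ∈ U) : val σ U x v = 1 := by
  simp [val, valN_mem hv]

lemma val_eq_sum {x : List V} {v : V} (hv : v ∉ U) :
    val σ U x v = ∑ w, step σ x v w * val σ U (x ++ [v]) w := by
  have h : val σ U x v = ⨆ n, valN σ U (n + 1) x v :=
    ((monotone_valN x v).iSup_nat_add 1).symm
  rw [h]
  simp only [valN_succ hv, val, ENNReal.mul_iSup]
  exact (ENNReal.finsetSum_iSup_of_monotone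
    (f := fun w n => step σ x v w * valN σ U n (x ++ [v]) w)
    fun w _ _ hmn => mul_le_mul_right (monotone_valN (x ++ [v]) w hmn) _).symm

/-- A superharmonic function that is at least `1` on `U` bounds the probability of visiting
`U`. -/
lemma val_le_of_superharmonic (φ : List V → V → ℝ≥0∞) (h1 : ∀ x, ∀ v ∈ U, 1 ≤ φ x v)
    (hφ : ∀ x, ∀ v ∉ U, ∑ w, step σ x v w * φ (x ++ [v]) w ≤ φ x v) (x : List V) (v : V) :
    val σ U x v ≤ φ x v := by
  refine iSup_le fun n => ?_
  induction n generalizing x v with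
  | zero =>
    by_cases hv : v ∈ U
    · simpa [valN_mem hv] using h1 x v hv
    · simp [valN, hv]
  | succ n ih =>
    by_cases hv : v ∈ U
    · simpa [valN_mem hv] using h1 x v hv
    · rw [valN_succ hv]
      exact (Finset.sum_le_sum fun w _ => mul_le_mul_right (ih _ _) _).trans (hφ x v hv)

lemma val_le_one (x : List V) (v : V) : val σ U x v ≤ 1 :=
  val_le_of_superharmonic (fun _ _ => 1) (fun _ _ _ => le_rfl)
    (fun x v _ => by simp [sum_step]) x v

lemma val_ne_top (x : List V) (v : V) : val σ U x v ≠ ∞ :=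
  ((val_le_one x v).trans_lt ENNReal.one_lt_top).ne

/-- The value of a history depends only on what the profile does from this history on. -/
lemma val_congr {x : List V} {v : V} (h0 : step σ x v = step σ' x v)
    (h : ∀ z w, step σ (x ++ v :: z) w = step σ' (x ++ v :: z) w) :
    val σ U x v = val σ' U x v := by
  refine iSup_congr fun n => ?_
  induction n generalizing x v with
  | zero => rfl
  | succ n ih =>
    by_cases hv : v ∈ U
    · simp [valN_mem hv]
    · rw [valN_succ hv, valN_succ hv, h0]
      refine Finset.sum_congr rfl fun w _ => ?_
      rw [ih (by simpa using h [] w) fun z w' => by simpa using h (w :: z) w']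

lemma step_of_owner {x : List V} {v : V} {i : P} (h : G.owner v = some i) :
    step σ x v = (σ i).dist x v h := by
  unfold step
  split
  · rename_i hj
    simp [h] at hj
  · rename_i j hj
    obtain rfl : j = i := by simpa [h] using hj.symm
    rfl

lemma step_of_stoch {x : List V} {v : V} (h : G.owner v = none) :
    step σ x v = G.stochStep v h := by
  unfold step
  split
  · rfl
  · rename_i hj
    simp [h] at hj

lemma step_update_of_owner_ne [DecidableEq P] {x : List V} {v : V} {i : P} (τ : G.Strategy i)
    (h : G.owner v ≠ some i) : step (Function.update σ i τ) x v = step σ x v := by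
  cases hv : G.owner v with
  | none => rw [step_of_stoch hv, step_of_stoch hv]
  | some j =>
    rw [step_of_owner hv, step_of_owner hv, Function.update_of_ne]
    rintro rfl
    exact h hv

/-! ### The payoff is the value of the initial history -/

lemma measurableSet_reach_upTo {V : Type} [MeasurableSpace V] [DiscreteMeasurableSpace V]
    (U : Set V) (n : ℕ) :
    MeasurableSet {ρ : ℕ → V | ∃ k ≤ n, ρ k ∈ U} := by
  have : {ρ : ℕ → V | ∃ k ≤ n, ρ k ∈ U} = ⋃ k, ⋃ _ : k ≤ n, (fun ρ => ρ k) ⁻¹' U := by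
    ext; simp
  rw [this]
  exact .iUnion fun k => .iUnion fun _ => measurable_pi_apply k (MeasurableSet.of_discrete)

section Measure

variable [MeasurableSpace V] [DiscreteMeasurableSpace V]

open Classical in
/-- The conditional probability that a play visits `U` up to time `a + d`, given its course up to
time `a`. -/
lemma lmarginalPartialTraj_reach (d a : ℕ) (ρ : ℕ → V) :
    Kernel.lmarginalPartialTraj (X := fun _ : ℕ => V) (stepKernel σ) a (a + d)
      ({ρ : ℕ → V | ∃ k ≤ a + d, ρ k ∈ U}.indicator 1) ρ =
    if ∃ k ≤ a, ρ k ∈ U then 1 else valN σ U d (List.ofFn fun k : Fin a => ρ k) (ρ a) := by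
  induction d generalizing a ρ with
  | zero =>
    rw [add_zero, Kernel.lmarginalPartialTraj_le _ le_rfl
      (measurable_one.indicator (measurableSet_reach_upTo U _))]
    by_cases h : ∃ k ≤ a, ρ k ∈ U
    · simp [Set.indicator, h]
    · have h' : ρ a ∉ U := fun ha => h ⟨a, le_rfl, ha⟩
      simp [Set.indicator, h, valN, h']
  | succ d ih =>
    have hm := (measurable_one (α := ℝ≥0∞)).indicator (measurableSet_reach_upTo U (a + (d + 1)))
    rw [← Kernel.lmarginalPartialTraj_self (b := a + 1) (by omega) (by omega) hm,
      Kernel.lmarginalPartialTraj_succ _ (Kernel.measurable_lmarginalPartialTraj _ _ hm),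
      lintegral_fintype]
    have e : a + (d + 1) = a + 1 + d := by ring
    simp only [e]
    simp only [ih]
    have hk : ∀ w, stepKernel σ a (Preorder.frestrictLe a ρ) {w} =
        step σ (List.ofFn fun k : Fin a => ρ k) (ρ a) w := by
      intro w
      simp only [stepKernel, Kernel.ofFunOfCountable, Kernel.coe_mk]
      rw [PMF.toMeasure_apply_singleton _ _ (MeasurableSet.singleton w)]
      rfl
    have hl : ∀ w, (List.ofFn fun k : Fin (a + 1) => Function.update ρ (a + 1) w k) =
        (List.ofFn fun k : Fin a => ρ k) ++ [ρ a] := by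
      intro w
      rw [List.ofFn_succ_last]
      congr 1
      · congr 1; funext k
        exact Function.update_of_ne (by simp; omega) _ _
      · rw [Function.update_of_ne (by simp)]; simp
    simp only [hk, hl, Function.update_self]
    by_cases h : ∃ k ≤ a, ρ k ∈ U
    · have h' : ∀ w, ∃ k ≤ a + 1, Function.update ρ (a + 1) w k ∈ U := by
        intro w
        obtain ⟨k, hk, hkU⟩ := h
        exact ⟨k, by omega, by rwa [Function.update_of_ne (by omega)]⟩
      simp [h, h', sum_step]
    · have ha : ρ a ∉ U := fun ha => h ⟨a, le_rfl, ha⟩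
      rw [if_neg h, valN_succ ha]
      refine Finset.sum_congr rfl fun w _ => ?_
      have h' : (∃ k ≤ a + 1, Function.update ρ (a + 1) w k ∈ U) ↔ w ∈ U := by
        constructor
        · rintro ⟨k, hk, hkU⟩
          rcases Nat.lt_or_ge a k with h1 | h1
          · obtain rfl : k = a + 1 := by omega
            simpa using hkU
          · rw [Function.update_of_ne (by omega)] at hkU
            exact absurd ⟨k, h1, hkU⟩ h
        · exact fun hw => ⟨a + 1, le_rfl, by simpa using hw⟩
      rw [mul_comm]
      by_cases hw : w ∈ U
      · simp [h', hw, valN_mem hw]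
      · simp [h', hw]

theorem payoff_eq_val (σ : G.Profile) (v₀ : V) (i : P) :
    payoff σ v₀ i = val σ (G.win i) [] v₀ := by
  have hU : reach (G.win i) = ⋃ n, {ρ : ℕ → V | ∃ k ≤ n, ρ k ∈ G.win i} := by
    ext ρ
    simp only [reach, Set.mem_ofPred_eq, Set.mem_iUnion]
    exact ⟨fun ⟨n, h⟩ => ⟨n, n, le_rfl, h⟩, fun ⟨_, k, _, h⟩ => ⟨k, h⟩⟩
  rw [payoff, hU, Monotone.measure_iUnion]
  · refine iSup_congr fun n => ?_
    have h := lmarginalPartialTraj_reach (σ := σ) (U := G.win i) n 0 (fun _ => v₀)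
    have hm := (measurable_one (α := ℝ≥0∞)).indicator (measurableSet_reach_upTo (G.win i) n)
    have hf : ∀ z : ℕ → V, ({ρ : ℕ → V | ∃ k ≤ n, ρ k ∈ G.win i}.indicator 1
        (Function.updateFinset (fun _ => v₀) (Finset.Iic n) (Preorder.frestrictLe n z)) : ℝ≥0∞) =
        {ρ : ℕ → V | ∃ k ≤ n, ρ k ∈ G.win i}.indicator 1 z := by
      intro z
      have : Function.updateFinset (fun _ => v₀) (Finset.Iic n) (Preorder.frestrictLe n z) ∈
          {ρ : ℕ → V | ∃ k ≤ n, ρ k ∈ G.win i} ↔ z ∈ {ρ : ℕ → V | ∃ k ≤ n, ρ k ∈ G.win i} := by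
        refine exists_congr fun k => and_congr_right fun hk => ?_
        simp [Function.updateFinset, hk]
      by_cases hz : z ∈ {ρ : ℕ → V | ∃ k ≤ n, ρ k ∈ G.win i}
      · rw [Set.indicator_of_mem (this.2 hz), Set.indicator_of_mem hz]
        rfl
      · rw [Set.indicator_of_notMem (mt this.1 hz), Set.indicator_of_notMem hz]
    rw [← lintegral_indicator_one (measurableSet_reach_upTo _ n)]
    rw [Kernel.lmarginalPartialTraj, zero_add, ← Kernel.traj_map_frestrictLe_apply,
      lintegral_map (f := fun z => {ρ : ℕ → V | ∃ k ≤ n, ρ k ∈ G.win i}.indicator 1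
        (Function.updateFinset (fun _ => v₀) (Finset.Iic n) z))
        (hm.comp measurable_updateFinset) (by fun_prop)] at h
    simp only [hf] at h
    refine Eq.trans h ?_
    by_cases hv : v₀ ∈ G.win i
    · simp [hv, valN_mem hv]
    · simp [hv]
  · intro m n hmn ρ ⟨k, hk, h⟩
    exact ⟨k, hk.trans hmn, h⟩

end Measure

/-! ### Best responses and one-shot deviations -/

section Nash

variable [MeasurableSpace V] [DiscreteMeasurableSpace V] [DecidableEq P]

/-- If no move of player `i` increases the value of the current history, then player `i` plays a
best response: the values stay superharmonic when her strategy is replaced. -/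
theorem isBestResponse_of_val_le {v₀ : V} {i : P}
    (h : ∀ x v w, G.owner v = some i → G.move v w →
      val σ (G.win i) (x ++ [v]) w ≤ val σ (G.win i) x v) :
    IsBestResponse σ v₀ i (σ i) := by
  intro τ
  rw [Function.update_eq_self, payoff_eq_val, payoff_eq_val]
  refine val_le_of_superharmonic (fun x v => val σ (G.win i) x v)
    (fun x v hv => (val_mem hv).ge) (fun x v hv => ?_) _ _
  by_cases ho : G.owner v = some i
  · calc ∑ w, step (Function.update σ i τ) x v w * val σ (G.win i) (x ++ [v]) w
        ≤ ∑ w, step (Function.update σ i τ) x v w * val σ (G.win i) x v := by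
          refine Finset.sum_le_sum fun w _ => ?_
          by_cases hw : step (Function.update σ i τ) x v w = 0
          · simp [hw]
          · refine mul_le_mul_right (h x v w ho ?_) _
            rw [step_of_owner ho] at hw
            exact (Function.update σ i τ i).legal x v ho w hw
      _ = val σ (G.win i) x v := by rw [← Finset.sum_mul, sum_step, one_mul]
  · rw [val_eq_sum hv]
    simp only [step_update_of_owner_ne τ ho]
    exact le_rfl

/-- The histories `x v` that have positive probability under `σ`. -/
inductive Reached (σ : G.Profile) (v₀ : V) : List V → V → Prop
  | nil : Reached σ v₀ [] v₀
  | snoc {x v w} : Reached σ v₀ x v → step σ x v w ≠ 0 → Reached σ v₀ (x ++ [v]) w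

open Classical in
/-- The strategy that moves to `w` after the history `x v` and agrees with `τ` elsewhere. -/
noncomputable def Strategy.modify {i : P} (τ : G.Strategy i) (x : List V) (v w : V)
    (hw : G.move v w) : G.Strategy i where
  dist y u hu := if y = x ∧ u = v then PMF.pure w else τ.dist y u hu
  legal y u hu w' h := by
    split_ifs at h with hy
    · obtain ⟨rfl, rfl⟩ := hy
      have : w' = w := by
        by_contra hne
        exact h (PMF.pure_apply_of_ne _ _ hne)
      rwa [this]
    · exact τ.legal y u hu w' h

/-- In a Nash equilibrium, no move of a player at a history of positive probability leads to a
larger value than the current one. Otherwise the player would profit from making this move at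
this history only. -/
theorem IsNash.val_le {v₀ : V} (hσ : IsNash σ v₀) {i : P} {x : List V} {v w : V}
    (hr : Reached σ v₀ x v) (ho : G.owner v = some i) (hm : G.move v w) (hv : v ∉ G.win i) :
    val σ (G.win i) (x ++ [v]) w ≤ val σ (G.win i) x v := by
  by_contra! hlt
  set σ' := Function.update σ i ((σ i).modify x v w hm) with hσ'
  have hstep : ∀ y u, ¬ (y = x ∧ u = v) → step σ' y u = step σ y u := by
    intro y u hne
    by_cases hu : G.owner u = some i
    · rw [step_of_owner hu, step_of_owner hu, hσ', Function.update_self]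
      simp [Strategy.modify, hne]
    · exact step_update_of_owner_ne _ hu
  have hstep' : step σ' x v = PMF.pure w := by
    rw [step_of_owner ho, hσ', Function.update_self]
    simp [Strategy.modify]
  -- After the deviation the two profiles agree, because histories only grow.
  have hafter : ∀ u, val σ' (G.win i) (x ++ [v]) u = val σ (G.win i) (x ++ [v]) u := fun u => by
    refine val_congr (hstep _ _ ?_) fun z w => hstep _ _ ?_ <;>
    · rintro ⟨h, -⟩
      simpa using congrArg List.length h
  have hxv : val σ' (G.win i) x v = val σ (G.win i) (x ++ [v]) w := by
    classical
    rw [val_eq_sum hv, hstep', Finset.sum_eq_single w]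
    · simp [hafter]
    · intro u _ hu
      rw [PMF.pure_apply_of_ne _ _ hu, zero_mul]
    · simp
  have hle : ∀ y u, val σ (G.win i) y u ≤ val σ' (G.win i) y u := by
    refine val_le_of_superharmonic _ (fun y u hu => (val_mem hu).ge) fun y u hu => ?_
    by_cases h : y = x ∧ u = v
    · obtain ⟨rfl, rfl⟩ := h
      simp only [hafter]
      rw [← val_eq_sum hu, hxv]
      exact hlt.le
    · rw [val_eq_sum (σ := σ') hu, hstep y u h]
  -- The strict gain at the deviation carries over to all histories that lead to it.
  have key : ∀ y u, Reached σ v₀ y u → val σ (G.win i) y u < val σ' (G.win i) y u →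
      val σ (G.win i) [] v₀ < val σ' (G.win i) [] v₀ := by
    intro y u hyu
    induction hyu with
    | nil => exact id
    | @snoc y u t hyu ht ih =>
      intro hgain
      apply ih
      have hu : u ∉ G.win i := by
        intro hu
        have ho' := (G.win_terminal i u hu t).1 ?_
        · subst ho'
          rw [val_mem hu, val_mem hu] at hgain
          exact lt_irrefl _ hgain
        · cases hou : G.owner u with
          | none =>
            refine Or.inl ⟨rfl, pos_iff_ne_zero.2 fun h0 => ht ?_⟩
            rw [step_of_stoch hou]
            simp [stochStep, h0]
          | some j =>
            rw [step_of_owner hou] at ht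
            exact Or.inr ⟨by simp, (σ j).legal _ _ hou _ ht⟩
      by_cases h : y = x ∧ u = v
      · obtain ⟨rfl, rfl⟩ := h
        rw [hafter] at hgain
        exact absurd hgain (lt_irrefl _)
      · rw [val_eq_sum hu, val_eq_sum hu, hstep y u h]
        classical
        rw [← Finset.add_sum_erase _ _ (Finset.mem_univ t),
          ← Finset.add_sum_erase _ _ (Finset.mem_univ t)]
        refine ENNReal.add_lt_add_of_lt_of_le ?_ ?_ ?_
        · exact ENNReal.sum_ne_top.2 fun w _ =>
            ENNReal.mul_ne_top ((step σ y u).apply_ne_top w) (val_ne_top _ _)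
        · exact (ENNReal.mul_lt_mul_iff_right ht ((step σ y u).apply_ne_top t)).2 hgain
        · exact Finset.sum_le_sum fun w _ => mul_le_mul_right (hle _ _) _
  refine absurd (hσ i ((σ i).modify x v w hm)) (not_le.2 ?_)
  rw [Function.update_eq_self, payoff_eq_val, payoff_eq_val]
  exact key x v hr (hxv ▸ hlt)

end Nash

end General

end SSMG

/-- A bounded function whose absolute value at least doubles along some map vanishes. The linear
relations between payoffs below follow from this, because the game continues in each round with
probability at most `1 / 2`. -/
lemma eq_zero_of_abs_le_half {α : Type*} (f : α → ℝ) (s : α → α) (M : ℝ) (hM : ∀ a, |f a| ≤ M)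
    (h : ∀ a, |f a| ≤ 1 / 2 * |f (s a)|) (a : α) : f a = 0 := by
  have key : ∀ n : ℕ, ∀ a, |f a| ≤ (1 / 2) ^ n * M := by
    intro n
    induction n with
    | zero => simpa using hM
    | succ n ih =>
      intro a
      calc |f a| ≤ 1 / 2 * |f (s a)| := h a
        _ ≤ 1 / 2 * ((1 / 2) ^ n * M) := by gcongr; exact ih _
        _ = (1 / 2) ^ (n + 1) * M := by ring
  have hlim : Filter.Tendsto (fun n : ℕ => (1 / 2 : ℝ) ^ n * M) Filter.atTop (nhds (0 * M)) :=
    (tendsto_pow_atTop_nhds_zero_of_lt_one (by norm_num) (by norm_num)).mul_const M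
  rw [zero_mul] at hlim
  exact abs_nonpos_iff.1 (ge_of_tendsto' hlim fun n => key n a)

namespace SSMG

section RealValue

variable {P V : Type} [Fintype P] [Fintype V] {G : SSMG P V} {σ : G.Profile} {i : P}

/-! ### Real values -/

/-- The conditional payoff of player `i` after the history `x v`, as a real number. -/
noncomputable def rval (σ : G.Profile) (i : P) (x : List V) (v : V) : ℝ :=
  (val σ (G.win i) x v).toReal

lemma rval_nonneg (x : List V) (v : V) : 0 ≤ rval σ i x v := ENNReal.toReal_nonneg

lemma rval_le_one (x : List V) (v : V) : rval σ i x v ≤ 1 :=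
  ENNReal.toReal_le_of_le_ofReal zero_le_one (by simpa using val_le_one x v)

lemma val_le_val_iff {x y : List V} {v w : V} :
    val σ (G.win i) x v ≤ val σ (G.win i) y w ↔ rval σ i x v ≤ rval σ i y w :=
  (ENNReal.toReal_le_toReal (val_ne_top _ _) (val_ne_top _ _)).symm

lemma rval_mem {x : List V} {v : V} (hv : v ∈ G.win i) : rval σ i x v = 1 := by
  simp [rval, val_mem hv]

lemma rval_eq_sum {x : List V} {v : V} (hv : v ∉ G.win i) :
    rval σ i x v = ∑ w, (step σ x v w).toReal * rval σ i (x ++ [v]) w := by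
  rw [rval, val_eq_sum hv, ENNReal.toReal_sum]
  · simp [rval]
  · exact fun w _ => ENNReal.mul_ne_top ((step σ x v).apply_ne_top w) (val_ne_top _ _)

lemma rval_of_step_eq_pure {x : List V} {v w : V} (hv : v ∉ G.win i)
    (h : step σ x v = PMF.pure w) : rval σ i x v = rval σ i (x ++ [v]) w := by
  classical
  rw [rval_eq_sum hv, h, Finset.sum_eq_single w]
  · simp
  · intro u _ hu
    rw [PMF.pure_apply_of_ne _ _ hu]
    simp
  · simp

lemma rval_of_stoch {x : List V} {v : V} (hv : v ∉ G.win i) (h : G.owner v = none) :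
    rval σ i x v = ∑ w, (G.prob v w : ℝ) * rval σ i (x ++ [v]) w := by
  rw [rval_eq_sum hv, step_of_stoch h]
  refine Finset.sum_congr rfl fun w _ => ?_
  have hc : (((G.prob v w : ℝ≥0)) : ℝ) = G.prob v w := by norm_cast
  simp [stochStep, hc]

lemma rval_of_absorbing {x : List V} {v : V} (hv : v ∉ G.win i)
    (h : ∀ y, step σ y v = PMF.pure v) : rval σ i x v = 0 := by
  classical
  have : val σ (G.win i) x v ≤ 0 := by
    have := val_le_of_superharmonic (σ := σ) (U := G.win i)
      (fun _ u => if u = v then (0 : ℝ≥0∞) else 1) (fun y u hu => ?_) (fun y u _ => ?_) x v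
    · simpa using this
    · have : u ≠ v := fun h => hv (h ▸ hu)
      simp [this]
    · by_cases huv : u = v
      · subst huv
        simp [h]
      · simp only [huv, if_false]
        calc _ ≤ ∑ w, step σ y u w * 1 := by
              refine Finset.sum_le_sum fun w _ => mul_le_mul_right ?_ _
              split_ifs <;> simp
          _ = 1 := by simp [sum_step]
  simp [rval, nonpos_iff_eq_zero.1 this]

lemma Strategy.IsPure.exists_step {x : List V} {v : V} (h : (σ i).IsPure)
    (hv : G.owner v = some i) : ∃ w, G.move v w ∧ step σ x v = PMF.pure w := by
  obtain ⟨w, hw⟩ := h x v hv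
  refine ⟨w, (σ i).legal x v hv w (by simp [hw]), ?_⟩
  rw [step_of_owner hv]
  ext u
  have hs := (PMF.apply_eq_one_iff _ _).1 hw
  by_cases hu : u = w
  · simp [hu, hw]
  · rw [PMF.pure_apply_of_ne _ _ hu, PMF.apply_eq_zero_iff, hs]
    exact hu

end RealValue

end SSMG

namespace CounterMachine

open SSMG

/-! ### The counter gadgets -/

/-- The game of the machine whose only instruction increments the first counter. -/
noncomputable abbrev incGame : SSMG Player (Vertex incMachine.m) := incMachine.game

variable {σ : incGame.Profile}

lemma mem_win_iff {p : Player} {v : Vertex incMachine.m} : v ∈ incGame.win p ↔ p ∈ winners v :=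
  Iff.rfl

lemma sum_cast_add_mul (f g : Vertex incMachine.m → ℚ≥0) (F : Vertex incMachine.m → ℝ) :
    ∑ w, ((f + g) w : ℝ) * F w = ∑ w, (f w : ℝ) * F w + ∑ w, (g w : ℝ) * F w := by
  simp [add_mul, Finset.sum_add_distrib]

lemma sum_cast_single_mul (a : Vertex incMachine.m) (q : ℚ≥0) (F : Vertex incMachine.m → ℝ) :
    ∑ w, ((Pi.single a q : Vertex incMachine.m → ℚ≥0) w : ℝ) * F w = q * F a := by
  rw [Finset.sum_eq_single a]
  · simp
  · intro w _ hw
    simp [Pi.single_eq_of_ne hw]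
  · simp

open Classical in
/-- The payoff of player `p` at a terminal vertex. -/
noncomputable def endPayoff (v : Vertex incMachine.m) (p : Player) : ℝ :=
  if p ∈ winners v then 1 else 0

lemma rval_terminal {x : List (Vertex incMachine.m)} {v : Vertex incMachine.m} {p : Player}
    (ho : owner v = none) (hp : prob v = Pi.single v 1) : rval σ p x v = endPayoff v p := by
  by_cases h : p ∈ winners v
  · rw [rval_mem h]; simp [endPayoff, h]
  · rw [rval_of_absorbing h]
    · simp [endPayoff, h]
    · intro y
      rw [step_of_stoch ho]
      ext w
      by_cases hw : w = v
      · subst hw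
        simp [stochStep, game, hp]
      · simp [stochStep, game, hp, hw]

lemma rval_leave (x : List (Vertex incMachine.m)) (i γ t r) (p : Player) :
    rval σ p x (.leave i γ t r) =
      ![1/3, 1/6, 1/3, 1/6] r * endPayoff .allWin p := by
  rw [rval_of_stoch (by simp [mem_win_iff, winners]) rfl]
  change ∑ w, ((prob _ w : ℚ≥0) : ℝ) * _ = _
  simp only [prob, sum_cast_add_mul, sum_cast_single_mul]
  rw [rval_terminal rfl rfl, rval_terminal rfl rfl]
  fin_cases r <;> simp [endPayoff, winners]

lemma rval_branch (x : List (Vertex incMachine.m)) (i γ t) (p : Player) :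
    rval σ p x (.branch i γ t) =
      1 / 2 * rval σ p (x ++ [.branch i γ t]) (.instr i γ t) +
      1 / 4 * rval σ p (x ++ [.branch i γ t]) (.ctl 0 γ t) +
      1 / 4 * rval σ p (x ++ [.branch i γ t]) (.ctl 1 γ t) := by
  rw [rval_of_stoch (by simp [mem_win_iff, winners]) rfl]
  change ∑ w, ((prob _ w : ℚ≥0) : ℝ) * _ = _
  simp only [prob, sum_cast_add_mul, sum_cast_single_mul]
  norm_num

lemma rval_grey (x : List (Vertex incMachine.m)) (j γ t) (p : Player) :
    rval σ p x (.grey j γ t) =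
      1 / 2 * rval σ p (x ++ [.grey j γ t]) (.ctl j γ t) +
      1 / 2 * endPayoff (.greyEnd j γ t) p := by
  rw [rval_of_stoch (by simp [mem_win_iff, winners]) rfl]
  change ∑ w, ((prob _ w : ℚ≥0) : ℝ) * _ = _
  simp only [prob, sum_cast_add_mul, sum_cast_single_mul]
  rw [rval_terminal (v := .greyEnd j γ t) rfl rfl]
  norm_num

lemma rval_row (x : List (Vertex incMachine.m)) (j γ t r) (p : Player) :
    rval σ p x (.row j γ t r) =
      1 / 2 * rval σ p (x ++ [.row j γ t r]) (![.row j γ t 1, .row j γ t 2, .last j γ t] r) +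
      1 / 2 * endPayoff (.rowEnd j γ t r) p := by
  rw [rval_of_stoch (by simp [mem_win_iff, winners]) rfl]
  change ∑ w, ((prob _ w : ℚ≥0) : ℝ) * _ = _
  simp only [prob, sum_cast_add_mul, sum_cast_single_mul]
  rw [rval_terminal (v := .rowEnd j γ t r) rfl rfl]
  norm_num

/-- The payoff of player `p` when the row of the gadget `C_{j,γ}^t` is entered. -/
noncomputable def rowPayoff (j : Fin 2) (γ : Label) (t : Bool) (p : Player) : ℝ :=
  1 / 2 * endPayoff (.rowEnd j γ t 0) p + 1 / 4 * endPayoff (.rowEnd j γ t 1) p +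
    1 / 8 * endPayoff (.rowEnd j γ t 2) p + 1 / 8 * endPayoff (.last j γ t) p

lemma rval_row_zero (x : List (Vertex incMachine.m)) (j γ t) (p : Player) :
    rval σ p x (.row j γ t 0) = rowPayoff j γ t p := by
  rw [rval_row]
  simp only [Matrix.cons_val_zero]
  rw [rval_row]
  simp only [Matrix.cons_val_one, Matrix.cons_val_zero]
  rw [rval_row]
  simp only [Matrix.cons_val]
  rw [rval_terminal rfl rfl, rowPayoff]
  ring

/-- The factor by which the position of the marked vertex in the row of `C_{j,γ}^t` scales the
probability of entering the row: `8` times the probability that the row ends at that vertex. -/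
def rowFactor (j : Fin 2) (γ : Label) : ℝ := ![4, 2, 1] (markedPos j γ)

lemma rowPayoff_A (j γ t) : rowPayoff j γ t (.A j t) = 7 / 8 := by
  have : ∀ r, endPayoff (.rowEnd j γ t r) (.A j t) = 1 := by
    intro r; simp only [endPayoff, winners]; split_ifs <;> simp_all
  simp only [rowPayoff, this]
  simp [endPayoff, winners]; norm_num

lemma rowPayoff_B (j γ t) : rowPayoff j γ t (.B j t) = 1 / 8 := by
  have : ∀ r, endPayoff (.rowEnd j γ t r) (.B j t) = 0 := by
    intro r; simp only [endPayoff, winners]; split_ifs <;> simp_all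
  simp only [rowPayoff, this]
  simp [endPayoff, winners]

lemma rowPayoff_A_not (j γ t) : rowPayoff j γ t (.A j (!t)) = rowFactor j γ / 8 := by
  have : ∀ r, endPayoff (.rowEnd j γ t r) (.A j (!t)) = if r = markedPos j γ then 1 else 0 := by
    intro r; simp only [endPayoff, winners]; split_ifs <;> simp_all
  simp only [rowPayoff, this, rowFactor]
  generalize markedPos j γ = r
  fin_cases r <;> simp [endPayoff, winners] <;> norm_num

lemma rowPayoff_B_not (j γ t) : rowPayoff j γ t (.B j (!t)) = 1 - rowFactor j γ / 8 := by
  have : ∀ r, endPayoff (.rowEnd j γ t r) (.B j (!t)) = if r = markedPos j γ then 0 else 1 := by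
    intro r; simp only [endPayoff, winners]; split_ifs <;> simp_all
  simp only [rowPayoff, this, rowFactor]
  generalize markedPos j γ = r
  fin_cases r <;> simp [endPayoff, winners] <;> norm_num

lemma rowPayoff_eq_one {p : Player} (hp : p = .zero ∨ p = .one) (j γ t) :
    rowPayoff j γ t p = 1 := by
  have : ∀ r, endPayoff (.rowEnd j γ t r) p = 1 := by
    intro r; rcases hp with rfl | rfl <;> simp only [endPayoff, winners] <;>
      split_ifs <;> simp_all
  simp only [rowPayoff, this]
  rcases hp with rfl | rfl <;> simp [endPayoff, winners] <;> norm_num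

lemma rowPayoff_of_ne {j j' : Fin 2} (h : j ≠ j') {p : Player} {u : Bool}
    (hp : p = .A j u ∨ p = .B j u) (γ t) : rowPayoff j' γ t p = 0 := by
  have : ∀ r, endPayoff (.rowEnd j' γ t r) p = 0 := by
    intro r; rcases hp with rfl | rfl <;> simp only [endPayoff, winners] <;>
      split_ifs <;> simp_all
  simp only [rowPayoff, this]
  rcases hp with rfl | rfl <;> simp [endPayoff, winners, h]

lemma step_ctl (hσ : (σ .zero).IsPure) (x : List (Vertex incMachine.m)) (j γ t) :
    step σ x (.ctl j γ t) = PMF.pure (.row j γ t 0) ∨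
      (step σ x (.ctl j γ t) = PMF.pure (.grey j γ t) ∧ γ ≠ .init ∧ γ ≠ .zero j) := by
  obtain ⟨w, hw, h⟩ := hσ.exists_step (x := x) (v := .ctl j γ t) rfl
  simp only [game, next] at hw
  split_ifs at hw with hγ
  · rw [h, hw]; exact Or.inl rfl
  · rcases hw with rfl | rfl
    · exact Or.inl h
    · exact Or.inr ⟨h, not_or.1 hγ⟩

lemma rval_ctl_of_row {x : List (Vertex incMachine.m)} {j γ t}
    (h : step σ x (.ctl j γ t) = PMF.pure (.row j γ t 0)) (p : Player) :
    rval σ p x (.ctl j γ t) = rowPayoff j γ t p := by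
  rw [rval_of_step_eq_pure (by simp [mem_win_iff, winners]) h, rval_row_zero]

lemma rval_ctl_of_grey {x : List (Vertex incMachine.m)} {j γ t}
    (h : step σ x (.ctl j γ t) = PMF.pure (.grey j γ t)) (p : Player) :
    rval σ p x (.ctl j γ t) =
      1 / 2 * rval σ p (x ++ [.ctl j γ t, .grey j γ t]) (.ctl j γ t) +
      1 / 2 * endPayoff (.greyEnd j γ t) p := by
  rw [rval_of_step_eq_pure (by simp [mem_win_iff, winners]) h, rval_grey]
  simp

/-- A linear relation between the payoffs of two players that holds at the row and at the end
behind the grey vertex holds at the entry of the counter gadget: the error is halved in each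
round through the grey vertex. -/
lemma rval_ctl_linear (hσ : (σ .zero).IsPure) {j γ t} {p q : Player} {a b m : ℝ}
    (hrow : a * rowPayoff j γ t p + b * rowPayoff j γ t q = m)
    (hgrey : a * endPayoff (.greyEnd j γ t) p + b * endPayoff (.greyEnd j γ t) q = m)
    (x : List (Vertex incMachine.m)) :
    a * rval σ p x (.ctl j γ t) + b * rval σ q x (.ctl j γ t) = m := by
  rw [← sub_eq_zero]
  refine eq_zero_of_abs_le_half
    (fun x => a * rval σ p x (.ctl j γ t) + b * rval σ q x (.ctl j γ t) - m)
    (fun x => x ++ [.ctl j γ t, .grey j γ t]) (|a| + |b| + |m|) (fun x => ?_) (fun x => ?_) x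
  · have hp : |rval σ p x (.ctl j γ t)| ≤ 1 := by
      rw [abs_of_nonneg (rval_nonneg _ _)]; exact rval_le_one _ _
    have hq : |rval σ q x (.ctl j γ t)| ≤ 1 := by
      rw [abs_of_nonneg (rval_nonneg _ _)]; exact rval_le_one _ _
    calc _ ≤ |a * rval σ p x (.ctl j γ t) + b * rval σ q x (.ctl j γ t)| + |m| := abs_sub _ _
      _ ≤ |a * rval σ p x (.ctl j γ t)| + |b * rval σ q x (.ctl j γ t)| + |m| := by
          gcongr; exact abs_add_le _ _
      _ ≤ |a| + |b| + |m| := by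
          rw [abs_mul, abs_mul]
          gcongr
          · exact mul_le_of_le_one_right (abs_nonneg _) hp
          · exact mul_le_of_le_one_right (abs_nonneg _) hq
  · rcases step_ctl hσ x j γ t with h | ⟨h, -⟩
    · simp only [rval_ctl_of_row h, hrow, sub_self, abs_zero]
      positivity
    · simp only [rval_ctl_of_grey h]
      rw [← abs_of_pos (show (0 : ℝ) < 1 / 2 by norm_num), ← abs_mul,
        abs_of_pos (show (0 : ℝ) < 1 / 2 by norm_num)]
      refine le_of_eq (congrArg _ ?_)
      linear_combination (1 / 2 : ℝ) * hgrey

variable {x : List (Vertex incMachine.m)} {j : Fin 2} {γ : Label} {t : Bool}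

lemma rval_ctl_add (hσ : (σ .zero).IsPure) (u : Bool) :
    rval σ (.A j u) x (.ctl j γ t) + rval σ (.B j u) x (.ctl j γ t) = 1 := by
  have h := fun hr hg => rval_ctl_linear hσ (j := j) (γ := γ) (t := t) (p := .A j u)
    (q := .B j u) (a := 1) (b := 1) (m := 1) hr hg x
  simp only [one_mul] at h
  rcases Bool.eq_or_eq_not u t with rfl | rfl
  · exact h (by rw [rowPayoff_A, rowPayoff_B]; norm_num) (by simp [endPayoff, winners])
  · exact h (by rw [rowPayoff_A_not, rowPayoff_B_not]; ring) (by simp [endPayoff, winners])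

lemma rval_ctl_A_not (hσ : (σ .zero).IsPure) :
    rval σ (.A j (!t)) x (.ctl j γ t) = rowFactor j γ * rval σ (.B j t) x (.ctl j γ t) := by
  have h := rval_ctl_linear hσ (j := j) (γ := γ) (t := t) (p := .A j (!t))
    (q := .B j t) (a := 1) (b := -rowFactor j γ) (m := 0)
    (by rw [rowPayoff_A_not, rowPayoff_B]; ring) (by simp [endPayoff, winners]) x
  linarith

lemma rval_ctl_eq_one (hσ : (σ .zero).IsPure) {p : Player} (hp : p = .zero ∨ p = .one) :
    rval σ p x (.ctl j γ t) = 1 := by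
  have h := rval_ctl_linear hσ (j := j) (γ := γ) (t := t) (p := p)
    (q := p) (a := 1) (b := 0) (m := 1) (by rw [rowPayoff_eq_one hp]; ring)
    (by rcases hp with rfl | rfl <;> simp [endPayoff, winners]) x
  linarith

lemma rval_ctl_of_ne (hσ : (σ .zero).IsPure) {j' : Fin 2} (hj : j ≠ j') {p : Player} {u : Bool}
    (hp : p = .A j u ∨ p = .B j u) : rval σ p x (.ctl j' γ t) = 0 := by
  have h := rval_ctl_linear hσ (j := j') (γ := γ) (t := t) (p := p)
    (q := p) (a := 1) (b := 0) (m := 0) (by rw [rowPayoff_of_ne hj hp]; ring)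
    (by rcases hp with rfl | rfl <;> simp [endPayoff, winners, hj]) x
  linarith

/-- The payoff of `A_j^u` or `B_j^u` at the branching vertex: only one of the two counter gadgets
contributes. -/
lemma rval_branch_player (hσ : (σ .zero).IsPure) {p : Player} {u : Bool}
    (hp : p = .A j u ∨ p = .B j u) (i : Fin (incMachine.m + 1)) :
    rval σ p x (.branch i γ t) =
      1 / 2 * rval σ p (x ++ [.branch i γ t]) (.instr i γ t) +
      1 / 4 * rval σ p (x ++ [.branch i γ t]) (.ctl j γ t) := by
  rw [rval_branch]
  fin_cases j
  · have := rval_ctl_of_ne hσ (x := x ++ [.branch i γ t]) (γ := γ) (t := t)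
      (show (0 : Fin 2) ≠ 1 by decide) hp
    simp only [Fin.zero_eta] at *
    linarith
  · have := rval_ctl_of_ne hσ (x := x ++ [.branch i γ t]) (γ := γ) (t := t)
      (show (1 : Fin 2) ≠ 0 by decide) hp
    simp only [Fin.mk_one] at *
    linarith

/-! ### Rounds of the simulation -/

/-- The part of the gadget `S_γ^t` that is passed before its `r`-th vertex. -/
def simPre (γ : Label) (t : Bool) : Fin 4 → List (Vertex incMachine.m) :=
  ![[], [.sim 0 γ t 0], [.sim 0 γ t 0, .sim 0 γ t 1],
    [.sim 0 γ t 0, .sim 0 γ t 1, .sim 0 γ t 2]]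

/-- The four controlled vertices of the gadget `S_γ^t`. -/
def simRun (γ : Label) (t : Bool) : List (Vertex incMachine.m) :=
  [.sim 0 γ t 0, .sim 0 γ t 1, .sim 0 γ t 2, .sim 0 γ t 3]

/-- The successor of the `r`-th vertex of the gadget `S_γ^t` that does not leave the gadget. -/
def simNext (γ : Label) (t : Bool) : Fin 4 → Vertex incMachine.m :=
  ![.sim 0 γ t 1, .sim 0 γ t 2, .sim 0 γ t 3, .branch 0 γ t]

/-- Nobody leaves the gadget `S_γ^t` when it is entered after the history `y`. -/
def Passes (σ : incGame.Profile) (y : List (Vertex incMachine.m)) (γ : Label) (t : Bool) : Prop :=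
  ∀ r, step σ (y ++ simPre γ t r) (.sim 0 γ t r) = PMF.pure (simNext γ t r)

lemma rval_sim_of_step {y : List (Vertex incMachine.m)} {γ t r}
    (h : step σ y (.sim 0 γ t r) = PMF.pure (simNext γ t r)) (p : Player) :
    rval σ p y (.sim 0 γ t r) = rval σ p (y ++ [.sim 0 γ t r]) (simNext γ t r) :=
  rval_of_step_eq_pure (by simp [mem_win_iff, winners]) h

lemma Passes.rval_sim {y : List (Vertex incMachine.m)} {γ t} (h : Passes σ y γ t) (p : Player)
    (r : Fin 4) : rval σ p (y ++ simPre γ t r) (.sim 0 γ t r) =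
      rval σ p (y ++ simRun γ t) (.branch 0 γ t) := by
  have h0 := rval_sim_of_step (h 0) p
  have h1 := rval_sim_of_step (h 1) p
  have h2 := rval_sim_of_step (h 2) p
  have h3 := rval_sim_of_step (h 3) p
  simp only [simPre, simNext, simRun, Matrix.cons_val, List.append_assoc, List.cons_append,
    List.nil_append] at *
  fin_cases r
  · exact h0.trans (h1.trans (h2.trans h3))
  · exact h1.trans (h2.trans h3)
  · exact h2.trans h3
  · exact h3

/-- The history at the branching vertex of the next round, where `x` is the history at the
branching vertex of `S_γ^t`. -/
def nextRound (x : List (Vertex incMachine.m)) (γ : Label) (t : Bool) :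
    List (Vertex incMachine.m) :=
  x ++ [.branch 0 γ t, .instr 0 γ t] ++ simRun (.inc 0) (!t)

lemma step_instr (hσ : (σ .zero).IsPure) (x : List (Vertex incMachine.m)) (γ t) :
    step σ x (.instr 0 γ t) = PMF.pure (.sim 0 (.inc 0) (!t) 0) := by
  obtain ⟨w, hw, h⟩ := hσ.exists_step (x := x) (v := .instr 0 γ t) rfl
  have hw' : w = .sim 0 (.inc 0) (!t) 0 := hw
  rw [h, hw']

lemma rval_instr (hσ : (σ .zero).IsPure) (x : List (Vertex incMachine.m)) (γ t) (p : Player) :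
    rval σ p x (.instr 0 γ t) =
      rval σ p (x ++ [.instr 0 γ t]) (.sim 0 (.inc 0) (!t) 0) :=
  rval_of_step_eq_pure (by simp [mem_win_iff, winners]) (step_instr hσ x γ t)

/-- A set of histories, given with the current label and parity, that end before a branching
vertex, are continued without leaving the next gadget, and are closed under this
continuation. -/
structure IsRunning (σ : incGame.Profile)
    (H : List (Vertex incMachine.m) → Label → Bool → Prop) : Prop where
  passes : ∀ {x γ t}, H x γ t → Passes σ (x ++ [.branch 0 γ t, .instr 0 γ t]) (.inc 0) (!t)
  next : ∀ {x γ t}, H x γ t → H (nextRound x γ t) (.inc 0) (!t)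

section Running

variable {H : List (Vertex incMachine.m) → Label → Bool → Prop}
  {x : List (Vertex incMachine.m)} {γ : Label} {t : Bool}

lemma IsRunning.rval_instr (hH : IsRunning σ H) (hσ : (σ .zero).IsPure) (hx : H x γ t)
    (p : Player) : rval σ p (x ++ [.branch 0 γ t]) (.instr 0 γ t) =
      rval σ p (nextRound x γ t) (.branch 0 (.inc 0) (!t)) := by
  rw [CounterMachine.rval_instr hσ]
  have := (hH.passes hx).rval_sim p 0
  simpa [simPre, nextRound] using this

/-- A linear relation between two payoffs at the branching vertices of a running set of histories
follows from the corresponding relation between the contributions of the counter gadgets. -/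
lemma IsRunning.rval_branch_linear (hH : IsRunning σ H) (hσ : (σ .zero).IsPure) {p q : Player}
    {b m : ℝ} (hc : ∀ x γ t, H x γ t →
      rval σ p x (.branch 0 γ t) + b * rval σ q x (.branch 0 γ t) =
        1 / 2 * (rval σ p (x ++ [.branch 0 γ t]) (.instr 0 γ t) +
          b * rval σ q (x ++ [.branch 0 γ t]) (.instr 0 γ t)) + 1 / 2 * m) (hx : H x γ t) :
    rval σ p x (.branch 0 γ t) + b * rval σ q x (.branch 0 γ t) = m := by
  rw [← sub_eq_zero]
  refine eq_zero_of_abs_le_half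
    (α := {a : List (Vertex incMachine.m) × Label × Bool // H a.1 a.2.1 a.2.2})
    (fun a => rval σ p a.1.1 (.branch 0 a.1.2.1 a.1.2.2) +
      b * rval σ q a.1.1 (.branch 0 a.1.2.1 a.1.2.2) - m)
    (fun a => ⟨(nextRound a.1.1 a.1.2.1 a.1.2.2, .inc 0, !a.1.2.2), hH.next a.2⟩)
    (1 + |b| + |m|) (fun a => ?_) (fun a => ?_) ⟨(x, γ, t), hx⟩
  · refine (abs_sub _ _).trans ?_
    gcongr
    refine (abs_add_le _ _).trans ?_
    rw [abs_mul, abs_of_nonneg (rval_nonneg _ _), abs_of_nonneg (rval_nonneg _ _)]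
    gcongr
    · exact rval_le_one _ _
    · exact mul_le_of_le_one_right (abs_nonneg _) (rval_le_one _ _)
  · have h := hc _ _ _ a.2
    rw [hH.rval_instr hσ a.2, hH.rval_instr hσ a.2] at h
    rw [h, ← abs_of_pos (show (0 : ℝ) < 1 / 2 by norm_num), ← abs_mul,
      abs_of_pos (show (0 : ℝ) < 1 / 2 by norm_num)]
    refine le_of_eq (congrArg _ ?_)
    ring

lemma IsRunning.rval_branch_add (hH : IsRunning σ H) (hσ : (σ .zero).IsPure) (hx : H x γ t)
    (j : Fin 2) (u : Bool) :
    rval σ (.A j u) x (.branch 0 γ t) + rval σ (.B j u) x (.branch 0 γ t) = 1 / 2 := by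
  have := hH.rval_branch_linear hσ (p := .A j u) (q := .B j u) (b := 1) (m := 1 / 2)
    (fun x γ t _ => ?_) hx
  · linarith
  · rw [rval_branch_player hσ (Or.inl rfl), rval_branch_player hσ (Or.inr rfl)]
    linear_combination (1 / 4 : ℝ) * rval_ctl_add hσ (x := x ++ [.branch 0 γ t]) (j := j)
      (γ := γ) (t := t) u

lemma IsRunning.rval_branch_eq_one (hH : IsRunning σ H) (hσ : (σ .zero).IsPure) (hx : H x γ t)
    {p : Player} (hp : p = .zero ∨ p = .one) : rval σ p x (.branch 0 γ t) = 1 := by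
  have := hH.rval_branch_linear hσ (p := p) (q := p) (b := 0) (m := 1) (fun x γ t _ => ?_) hx
  · linarith
  · rw [rval_branch, rval_ctl_eq_one hσ hp, rval_ctl_eq_one hσ hp]
    ring

/-- The payoff of `B_j^t` in the counter gadget `C_{j,γ}^t` that is entered from the branching
vertex after the history `x`. It is `1/8` of the probability of entering the row of the gadget,
and thus encodes the value of the counter. -/
noncomputable def counterValue (σ : incGame.Profile) (j : Fin 2)
    (x : List (Vertex incMachine.m)) (γ : Label) (t : Bool) : ℝ :=
  rval σ (.B j t) (x ++ [.branch 0 γ t]) (.ctl j γ t)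

/-- The payoff of `A_j^t` after two rounds. -/
lemma IsRunning.rval_branch_A (hH : IsRunning σ H) (hσ : (σ .zero).IsPure) (hx : H x γ t)
    (j : Fin 2) :
    rval σ (.A j t) x (.branch 0 γ t) =
      1 / 4 * rval σ (.A j t) (nextRound (nextRound x γ t) (.inc 0) (!t)) (.branch 0 (.inc 0) t) +
      1 / 8 * (rowFactor j (.inc 0) * counterValue σ j (nextRound x γ t) (.inc 0) (!t)) +
      1 / 4 * (1 - counterValue σ j x γ t) := by
  rw [rval_branch_player hσ (Or.inl rfl), hH.rval_instr hσ hx,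
    rval_branch_player hσ (Or.inl rfl), hH.rval_instr hσ (hH.next hx)]
  have h1 := rval_ctl_add hσ (x := x ++ [.branch 0 γ t]) (j := j) (γ := γ) (t := t) t
  have h2 := rval_ctl_A_not hσ (x := nextRound x γ t ++ [.branch 0 (.inc 0) (!t)]) (j := j)
    (γ := .inc 0) (t := !t)
  simp only [Bool.not_not] at h2 ⊢
  rw [h2]
  simp only [counterValue]
  linear_combination (1 / 4 : ℝ) * h1

end Running

/-! ### No finite-state equilibrium -/

section FiniteState

variable {y x : List (Vertex incMachine.m)} {γ : Label} {t : Bool}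

lemma reached_pure {x : List (Vertex incMachine.m)} {v w : Vertex incMachine.m}
    (h : Reached σ .start x v) (hs : step σ x v = PMF.pure w) :
    Reached σ .start (x ++ [v]) w :=
  h.snoc (by simp [hs])

/-- The payoff that a player of the gadget `S_γ^t` gets by leaving it at its `r`-th vertex. -/
noncomputable def leavePayoff (r : Fin 4) : ℝ := ![1/3, 1/6, 1/3, 1/6] r

/-- The controller of the `r`-th vertex of a gadget with parity `t`. -/
def simOwner (t : Bool) (r : Fin 4) : Player := ![.A 0 t, .B 0 t, .A 1 t, .B 1 t] r

lemma rval_leave_simOwner (x : List (Vertex incMachine.m)) (i γ t r) :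
    rval σ (simOwner t r) x (.leave i γ t r) = leavePayoff r := by
  rw [rval_leave]
  fin_cases r <;> simp [endPayoff, winners, simOwner, leavePayoff]

/-- As long as player `1` still wins almost surely, nobody leaves the gadget. -/
lemma step_sim (hσ : ∀ i, (σ i).IsPure) {r : Fin 4}
    (h1 : rval σ .one y (.sim 0 γ t r) = 1) :
    step σ y (.sim 0 γ t r) = PMF.pure (simNext γ t r) := by
  obtain ⟨w, hw, h⟩ := (hσ (simOwner t r)).exists_step (x := y) (v := .sim 0 γ t r) rfl
  rcases hw with rfl | hw
  · exact h
  · obtain rfl : w = .leave 0 γ t r := hw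
    rw [rval_of_step_eq_pure (by simp [mem_win_iff, winners]) h, rval_leave] at h1
    simp [endPayoff, winners] at h1

lemma le_rval_sim (hN : IsNash σ .start) {r : Fin 4} (hr : Reached σ .start y (.sim 0 γ t r)) :
    leavePayoff r ≤ rval σ (simOwner t r) y (.sim 0 γ t r) := by
  rw [← rval_leave_simOwner (σ := σ) (y ++ [.sim 0 γ t r]) 0 γ t r, ← val_le_val_iff]
  exact hN.val_le hr rfl (Or.inr rfl) (by simp [mem_win_iff, winners])

/-- The histories of positive probability that end before a branching vertex, where player `1`
still wins almost surely and neither `A_1^t` nor `B_1^t` would have profited from leaving the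
preceding gadget. -/
structure Runs (σ : incGame.Profile) (x : List (Vertex incMachine.m)) (γ : Label) (t : Bool) :
    Prop where
  reached : Reached σ .start x (.branch 0 γ t)
  one : rval σ .one x (.branch 0 γ t) = 1
  A : 1 / 3 ≤ rval σ (.A 0 t) x (.branch 0 γ t)
  B : 1 / 6 ≤ rval σ (.B 0 t) x (.branch 0 γ t)

lemma runs_of_reached_sim (hσ : ∀ i, (σ i).IsPure) (hN : IsNash σ .start)
    (hr : Reached σ .start y (.sim 0 γ t 0)) (h1 : rval σ .one y (.sim 0 γ t 0) = 1) :
    Passes σ y γ t ∧ Runs σ (y ++ simRun γ t) γ t := by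
  have s0 := step_sim hσ h1
  rw [rval_sim_of_step s0] at h1
  have r1 := reached_pure hr s0
  have s1 := step_sim (r := 1) hσ h1
  have e1 := h1
  rw [simNext, Matrix.cons_val_zero, rval_sim_of_step s1] at h1
  have r2 := reached_pure r1 s1
  have s2 := step_sim (r := 2) hσ h1
  rw [simNext, Matrix.cons_val_one, Matrix.cons_val_zero, rval_sim_of_step s2] at h1
  have r3 := reached_pure r2 s2
  have s3 := step_sim (r := 3) hσ h1
  have r4 := reached_pure r3 s3
  have hp : Passes σ y γ t := by
    intro r
    fin_cases r
    · simpa [simPre] using s0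
    · simpa [simPre] using s1
    · simpa [simPre] using s2
    · simpa [simPre] using s3
  refine ⟨hp, by simpa [simRun, simNext] using r4, ?_, ?_, ?_⟩
  · rw [← hp.rval_sim .one 1]
    simpa [simPre, simNext] using e1
  · rw [← hp.rval_sim (.A 0 t) 0]
    simpa [simPre, leavePayoff, simOwner] using le_rval_sim hN hr
  · rw [← hp.rval_sim (.B 0 t) 1]
    simpa [simPre, leavePayoff, simOwner] using le_rval_sim (r := 1) hN r1

lemma isRunning_runs (hσ : ∀ i, (σ i).IsPure) (hN : IsNash σ .start) : IsRunning σ (Runs σ) := by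
  have key : ∀ {x γ t}, Runs σ x γ t →
      Passes σ (x ++ [.branch 0 γ t, .instr 0 γ t]) (.inc 0) (!t) ∧
        Runs σ (nextRound x γ t) (.inc 0) (!t) := by
    intro x γ t hx
    have hr : Reached σ .start (x ++ [.branch 0 γ t]) (.instr 0 γ t) := by
      refine hx.reached.snoc ?_
      rw [step_of_stoch rfl]
      simp [stochStep, game, prob]
    have hr' := reached_pure hr (step_instr (hσ .zero) _ γ t)
    have h1 := hx.one
    rw [rval_branch, rval_ctl_eq_one (hσ .zero) (Or.inr rfl),
      rval_ctl_eq_one (hσ .zero) (Or.inr rfl), rval_instr (hσ .zero)] at h1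
    rw [List.append_assoc] at hr' h1
    refine runs_of_reached_sim hσ hN hr' ?_
    simp only [List.cons_append, List.nil_append] at *
    linarith
  exact ⟨fun h => (key h).1, fun h => (key h).2⟩

/-- In an equilibrium the counter is incremented in each round, that is, the probability of
entering the row is halved. -/
lemma Runs.counterValue_next (hσ : ∀ i, (σ i).IsPure) (hN : IsNash σ .start) (hx : Runs σ x γ t) :
    counterValue σ 0 (nextRound x γ t) (.inc 0) (!t) = counterValue σ 0 x γ t / 2 := by
  have hH := isRunning_runs hσ hN
  -- The payoffs of `A` and `B` sum up to `1 / 2`, so the two lower bounds are attained.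
  have hA : ∀ {x γ t}, Runs σ x γ t → rval σ (.A 0 t) x (.branch 0 γ t) = 1 / 3 := by
    intro x γ t hx
    have := hH.rval_branch_add (hσ .zero) hx 0 t
    linarith [hx.A, hx.B]
  have h := hH.rval_branch_A (hσ .zero) hx 0
  have h2 := hA (hH.next (hH.next hx))
  rw [Bool.not_not] at h2
  rw [hA hx, h2] at h
  have hf : rowFactor 0 (.inc 0) = 4 := by simp [rowFactor, markedPos]
  rw [hf] at h
  linarith

lemma counterValue_congr (hσ : (σ .zero).IsPure) {x x' : List (Vertex incMachine.m)}
    {j γ t} (h : (σ .zero).histSetoid (x ++ [.branch 0 γ t]) (x' ++ [.branch 0 γ t])) :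
    counterValue σ j x γ t = counterValue σ j x' γ t := by
  have hs : ∀ {y y' : List (Vertex incMachine.m)}, (σ .zero).histSetoid y y' →
      step σ y (.ctl j γ t) = step σ y' (.ctl j γ t) := by
    intro y y' h
    rw [step_of_owner rfl, step_of_owner rfl]
    simpa using h [] (.ctl j γ t) rfl
  have := eq_zero_of_abs_le_half
    (α := {a : List (Vertex incMachine.m) × List (Vertex incMachine.m) //
      (σ .zero).histSetoid a.1 a.2})
    (fun a => rval σ (.B j t) a.1.1 (.ctl j γ t) - rval σ (.B j t) a.1.2 (.ctl j γ t))
    (fun a => ⟨(a.1.1 ++ [.ctl j γ t, .grey j γ t], a.1.2 ++ [.ctl j γ t, .grey j γ t]),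
      fun z v hv => by
        rw [List.append_assoc, List.append_assoc]
        exact a.2 ([.ctl j γ t, .grey j γ t] ++ z) v hv⟩) 1
    (fun a => ?_) (fun a => ?_) ⟨(_, _), h⟩
  · exact sub_eq_zero.1 this
  · rw [abs_sub_le_iff]
    constructor <;>
    linarith [rval_nonneg (σ := σ) (i := .B j t) a.1.1 (.ctl j γ t),
      rval_le_one (σ := σ) (i := .B j t) a.1.1 (.ctl j γ t),
      rval_nonneg (σ := σ) (i := .B j t) a.1.2 (.ctl j γ t),
      rval_le_one (σ := σ) (i := .B j t) a.1.2 (.ctl j γ t)]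
  · rcases step_ctl hσ a.1.1 j γ t with h1 | ⟨h1, -⟩
    · simp only [rval_ctl_of_row h1, rval_ctl_of_row ((hs a.2).symm.trans h1), sub_self, abs_zero]
      positivity
    · simp only [rval_ctl_of_grey h1, rval_ctl_of_grey ((hs a.2).symm.trans h1)]
      rw [← abs_of_pos (show (0 : ℝ) < 1 / 2 by norm_num), ← abs_mul,
        abs_of_pos (show (0 : ℝ) < 1 / 2 by norm_num)]
      refine le_of_eq (congrArg _ ?_)
      ring

/-- The label in the `n`-th round. -/
def roundLabel : ℕ → Label
  | 0 => .init
  | _ + 1 => .inc 0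

/-- The history at the branching vertex of the `n`-th round. -/
def roundHist : ℕ → List (Vertex incMachine.m)
  | 0 => [.start] ++ simRun .init false
  | n + 1 => nextRound (roundHist n) (roundLabel n) n.bodd

theorem not_exists_finiteState :
    ¬ ∃ σ : incGame.Profile, IsFiniteStateProfile σ ∧ IsNash σ .start ∧
      0 < payoff σ .start .zero := by
  rintro ⟨σ, hF, hN, h0⟩
  have hσ : ∀ i, (σ i).IsPure := fun i => (hF i).1
  -- Player `1` could obtain the payoff `1` at once, so she has it in the equilibrium.
  have hone : rval σ .one [] .start = 1 := by
    refine le_antisymm (rval_le_one _ _) ?_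
    have := val_le_val_iff.1 (hN.val_le (i := .one) (w := .quit) Reached.nil rfl (Or.inr rfl)
      (by simp [mem_win_iff, winners]))
    rwa [rval_terminal rfl rfl, show endPayoff (.quit : Vertex incMachine.m) .one = 1 by
      simp [endPayoff, winners]] at this
  have hstart : step σ [] .start = PMF.pure (.sim 0 .init false 0) := by
    obtain ⟨w, hw, h⟩ := (hσ .one).exists_step (x := []) (v := .start) rfl
    rcases hw with rfl | hw
    · exact h
    · obtain rfl : w = .quit := hw
      have hz : rval σ .zero [] .start = 0 := by
        rw [rval_of_step_eq_pure (by simp [mem_win_iff, winners]) h, rval_terminal rfl rfl]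
        simp [endPayoff, winners]
      have hz' : val σ (incGame.win .zero) [] .start = 0 :=
        (ENNReal.toReal_eq_zero_iff _).1 hz |>.resolve_right (val_ne_top _ _)
      rw [payoff_eq_val, hz'] at h0
      exact absurd h0 (lt_irrefl _)
  have hruns : ∀ n, Runs σ (roundHist n) (roundLabel n) n.bodd := by
    intro n
    induction n with
    | zero =>
      refine (runs_of_reached_sim hσ hN (reached_pure .nil hstart) ?_).2
      rwa [rval_of_step_eq_pure (by simp [mem_win_iff, winners]) hstart] at hone
    | succ n ih =>
      rw [Nat.bodd_succ]
      exact (isRunning_runs hσ hN).next ih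
  have hval : ∀ n, counterValue σ 0 (roundHist n) (roundLabel n) n.bodd = (1 / 2) ^ n / 8 := by
    intro n
    induction n with
    | zero =>
      -- The label `init` does not allow a move to the grey vertex.
      rcases step_ctl (hσ .zero) (roundHist 0 ++ [.branch 0 .init false]) 0 .init false with h | h
      · change rval σ _ _ _ = _
        rw [roundLabel, Nat.bodd_zero, rval_ctl_of_row h, rowPayoff_B]
        norm_num
      · exact absurd rfl h.2.1
    | succ n ih =>
      rw [Nat.bodd_succ]
      refine ((hruns n).counterValue_next hσ hN).trans ?_
      rw [ih]
      ring
  -- Two rounds of even parity with equivalent histories have equal counter values.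
  have := (hF .zero).2
  obtain ⟨m, n, hmn, h⟩ := Finite.exists_ne_map_eq_of_infinite fun n : ℕ =>
    (Quotient.mk (σ .zero).histSetoid (roundHist (2 * n + 2) ++ [.branch 0 (.inc 0) false]))
  have hc := counterValue_congr (j := 0) (hσ .zero) (Quotient.exact h)
  have hv : ∀ n, counterValue σ 0 (roundHist (2 * n + 2)) (.inc 0) false =
      (1 / 2) ^ (2 * n + 2) / 8 := by
    intro n
    simpa [roundLabel] using hval (2 * n + 2)
  rw [hv, hv, div_left_inj' (by norm_num)] at hc
  have := pow_right_injective₀ (by norm_num) (by norm_num) hc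
  omega

end FiniteState

/-! ### A pure equilibrium -/

section Equilibrium

/-- The effect of a visited vertex on the counter: an instruction vertex increments it, starting
from `0` if the label is `init` or `zero`, and a grey vertex decrements it, so that in a counter
gadget it is the number of visits to the grey vertex that are still to come. -/
def countStep (c : ℕ) : Vertex incMachine.m → ℕ
  | .instr _ γ _ => if γ = .init ∨ γ = .zero 0 then 1 else c + 1
  | .grey _ _ _ => c - 1
  | _ => c

/-- The value of the first counter after a history. -/
def count (x : List (Vertex incMachine.m)) : ℕ := x.foldl countStep 0

/-- The move of the pure equilibrium after the history `x v`: nobody leaves, player `0` visits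
the grey vertex of the first counter as often as the counter says, and never that of the
second one. -/
def choice (x : List (Vertex incMachine.m)) : Vertex incMachine.m → Vertex incMachine.m
  | .start => .sim 0 .init false 0
  | .sim i γ t r => ![.sim i γ t 1, .sim i γ t 2, .sim i γ t 3, .branch i γ t] r
  | .instr _ _ t => .sim 0 (.inc 0) (!t) 0
  | .ctl j γ t =>
      if j = 0 ∧ ¬ (γ = .init ∨ γ = .zero 0) ∧ 0 < count x then .grey j γ t else .row j γ t 0
  | v => v

lemma choice_legal (x : List (Vertex incMachine.m)) (v : Vertex incMachine.m) {p : Player}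
    (hv : incGame.owner v = some p) : incGame.move v (choice x v) := by
  cases v with
  | start => exact Or.inl rfl
  | sim i γ t r => exact Or.inl rfl
  | instr i γ t => rfl
  | ctl j γ t =>
    change _ ∈ next _ _
    simp only [choice, next]
    by_cases h : j = 0 ∧ ¬ (γ = .init ∨ γ = .zero 0) ∧ 0 < count x
    · obtain ⟨rfl, hγ, hc⟩ := h
      rw [if_neg hγ, if_pos ⟨rfl, hγ, hc⟩]
      exact Or.inr rfl
    · rw [if_neg h]
      split_ifs
      · rfl
      · exact Or.inl rfl
  | _ => cases hv

/-- The pure equilibrium. -/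
noncomputable def pureProfile : incGame.Profile := fun _ =>
  { dist := fun x v _ => PMF.pure (choice x v)
    legal := fun x v hv w hw => by
      have : w = choice x v := by
        by_contra h
        exact hw (PMF.pure_apply_of_ne _ _ h)
      exact this ▸ choice_legal x v hv }

lemma isPure_pureProfile (p : Player) : (pureProfile p).IsPure :=
  fun x v _ => ⟨choice x v, by simp [pureProfile]⟩

lemma step_pureProfile (x : List (Vertex incMachine.m)) {v : Vertex incMachine.m} {p : Player}
    (hv : owner v = some p) : step pureProfile x v = PMF.pure (choice x v) :=
  step_of_owner hv

lemma isRunning_pureProfile : IsRunning pureProfile fun _ _ _ => True where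
  passes _ r := by
    rw [step_pureProfile _ rfl]
    rfl
  next _ := trivial

lemma count_append (x y : List (Vertex incMachine.m)) :
    count (x ++ y) = y.foldl countStep (count x) := by
  simp [count]

/-- If the first counter has the value `c`, then the row of its gadget is entered with
probability `2⁻ᶜ`. -/
lemma rval_ctl_pureProfile {γ : Label} (hγ : ¬ (γ = .init ∨ γ = .zero 0)) (t : Bool) (c : ℕ) :
    ∀ x, count x = c → rval pureProfile (.B 0 t) x (.ctl 0 γ t) = (1 / 2) ^ c / 8 := by
  induction c with
  | zero =>
    intro x hx
    rw [rval_ctl_of_row (by rw [step_pureProfile _ rfl]; simp [choice, hx]), rowPayoff_B]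
    norm_num
  | succ c ih =>
    intro x hx
    rw [rval_ctl_of_grey (by rw [step_pureProfile _ rfl]; simp [choice, hx, hγ]), ih]
    · simp [endPayoff, winners]; ring
    · simp [count_append, countStep, hx]

lemma counterValue_pureProfile_zero (x : List (Vertex incMachine.m)) (γ t) :
    counterValue pureProfile 0 x γ t =
      (1 / 2) ^ (if γ = .init ∨ γ = .zero 0 then 0 else count x) / 8 := by
  rw [counterValue]
  split_ifs with hγ
  · rw [rval_ctl_of_row (by rw [step_pureProfile _ rfl]; simp [choice, hγ]), rowPayoff_B]
    norm_num
  · exact rval_ctl_pureProfile hγ t _ _ (by simp [count_append, countStep])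

lemma counterValue_pureProfile_one (x : List (Vertex incMachine.m)) (γ t) :
    counterValue pureProfile 1 x γ t = 1 / 8 := by
  rw [counterValue, rval_ctl_of_row (by rw [step_pureProfile _ rfl]; simp [choice]), rowPayoff_B]

/-- The counters are updated according to the label `inc(1)`, hence the contributions of two
consecutive counter gadgets to the payoff of `A_j^t` balance out. -/
lemma counterValue_pureProfile_next (j : Fin 2) (x : List (Vertex incMachine.m)) (γ t) :
    rowFactor j (.inc 0) * counterValue pureProfile j (nextRound x γ t) (.inc 0) (!t) =
      2 * counterValue pureProfile j x γ t := by
  fin_cases j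
  · simp only [Fin.zero_eta, counterValue_pureProfile_zero]
    have h : count (nextRound x γ t) = (if γ = .init ∨ γ = .zero 0 then 0 else count x) + 1 := by
      simp only [nextRound, simRun, count_append, List.foldl_cons, List.foldl_nil, countStep]
      split_ifs <;> rfl
    have hf : rowFactor 0 (.inc 0) = 4 := by simp [rowFactor, markedPos]
    rw [h, hf, if_neg (by simp), pow_succ]
    ring
  · simp only [Fin.mk_one, counterValue_pureProfile_one]
    simp [rowFactor, markedPos]

lemma rval_branch_pureProfile_A (j : Fin 2) (x : List (Vertex incMachine.m)) (γ t) :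
    rval pureProfile (.A j t) x (.branch 0 γ t) = 1 / 3 := by
  rw [← sub_eq_zero]
  refine eq_zero_of_abs_le_half
    (fun a : List (Vertex incMachine.m) × Label =>
      rval pureProfile (.A j t) a.1 (.branch 0 a.2 t) - 1 / 3)
    (fun a => (nextRound (nextRound a.1 a.2 t) (.inc 0) (!t), .inc 0)) 1 (fun a => ?_)
    (fun a => ?_) (x, γ)
  · rw [abs_sub_le_iff]
    constructor <;> linarith [rval_nonneg (σ := pureProfile) (i := .A j t) a.1 (.branch 0 a.2 t),
      rval_le_one (σ := pureProfile) (i := .A j t) a.1 (.branch 0 a.2 t)]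
  · have h := isRunning_pureProfile.rval_branch_A (isPure_pureProfile _) (x := a.1) (γ := a.2)
      (t := t) trivial j
    rw [counterValue_pureProfile_next] at h
    have h' : rval pureProfile (.A j t) a.1 (.branch 0 a.2 t) - 1 / 3 =
        1 / 4 * (rval pureProfile (.A j t) (nextRound (nextRound a.1 a.2 t) (.inc 0) (!t))
          (.branch 0 (.inc 0) t) - 1 / 3) := by
      linarith
    rw [h', abs_mul, abs_of_pos (show (0 : ℝ) < 1 / 4 by norm_num)]
    gcongr
    norm_num

lemma rval_branch_pureProfile (x : List (Vertex incMachine.m)) (γ t) (r : Fin 4) :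
    rval pureProfile (simOwner t r) x (.branch 0 γ t) = leavePayoff r := by
  have hA := fun j => rval_branch_pureProfile_A j x γ t
  have hB := fun j => isRunning_pureProfile.rval_branch_add (isPure_pureProfile _) (x := x)
    (γ := γ) (t := t) trivial j t
  fin_cases r
  · exact hA 0
  · change rval pureProfile (.B 0 t) _ _ = 1 / 6
    linarith [hA 0, hB 0]
  · exact hA 1
  · change rval pureProfile (.B 1 t) _ _ = 1 / 6
    linarith [hA 1, hB 1]

/-- At each vertex of a gadget, going on is as good for its controller as leaving. -/
lemma rval_sim_pureProfile (x : List (Vertex incMachine.m)) (γ t) (r : Fin 4) :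
    rval pureProfile (simOwner t r) x (.sim 0 γ t r) = leavePayoff r := by
  have hn : ∀ x p r, rval pureProfile p x (.sim 0 γ t r) =
      rval pureProfile p (x ++ [.sim 0 γ t r]) (simNext γ t r) := fun x p r =>
    rval_sim_of_step (step_pureProfile _ rfl) p
  have h3 : ∀ x p, rval pureProfile p x (.sim 0 γ t 3) =
    rval pureProfile p (x ++ [.sim 0 γ t 3]) (.branch 0 γ t) := fun x p => hn x p 3
  have h2 : ∀ x p, rval pureProfile p x (.sim 0 γ t 2) =
    rval pureProfile p (x ++ [.sim 0 γ t 2]) (.sim 0 γ t 3) := fun x p => hn x p 2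
  have h1 : ∀ x p, rval pureProfile p x (.sim 0 γ t 1) =
    rval pureProfile p (x ++ [.sim 0 γ t 1]) (.sim 0 γ t 2) := fun x p => hn x p 1
  have h0 : ∀ x p, rval pureProfile p x (.sim 0 γ t 0) =
    rval pureProfile p (x ++ [.sim 0 γ t 0]) (.sim 0 γ t 1) := fun x p => hn x p 0
  have hb := fun x => rval_branch_pureProfile x γ t r
  fin_cases r
  · exact (h0 _ _).trans ((h1 _ _).trans ((h2 _ _).trans ((h3 _ _).trans (hb _))))
  · exact (h1 _ _).trans ((h2 _ _).trans ((h3 _ _).trans (hb _)))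
  · exact (h2 _ _).trans ((h3 _ _).trans (hb _))
  · exact (h3 _ _).trans (hb _)

lemma payoff_pureProfile {p : Player} (hp : p = .zero ∨ p = .one) :
    payoff pureProfile .start p = 1 := by
  have hs : step pureProfile [] .start = PMF.pure (.sim 0 .init false 0) :=
    step_pureProfile _ rfl
  have hpass : Passes pureProfile [.start] .init false := fun r => step_pureProfile _ rfl
  have h : rval pureProfile p [] .start = 1 := by
    rw [rval_of_step_eq_pure (by simp [mem_win_iff, winners]) hs]
    refine (hpass.rval_sim p 0).trans ?_
    exact isRunning_pureProfile.rval_branch_eq_one (isPure_pureProfile _) trivial hp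
  rw [payoff_eq_val]
  exact (ENNReal.toReal_eq_one_iff _).1 h

lemma isBestResponse_of_payoff_eq_one {p : Player} {σ : incGame.Profile}
    (h : payoff σ .start p = 1) : IsBestResponse σ .start p (σ p) := by
  intro τ
  rw [Function.update_eq_self, h, payoff_eq_val]
  exact val_le_one _ _

lemma isNash_pureProfile : IsNash pureProfile .start := by
  have hsim : ∀ p, p ≠ .zero → p ≠ .one → IsBestResponse pureProfile .start p (pureProfile p) := by
    intro p hp0 hp1
    refine isBestResponse_of_val_le fun x v w ho hm => val_le_val_iff.2 ?_
    have ho' : owner v = some p := ho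
    cases v with
    | sim i γ t r =>
      obtain rfl : i = 0 := Subsingleton.elim (α := Fin 1) _ _
      obtain rfl : simOwner t r = p := by simpa [owner, simOwner] using ho'
      rcases hm with rfl | hm
      · exact (rval_sim_of_step (step_pureProfile _ rfl) _).ge
      · obtain rfl : w = .leave 0 γ t r := hm
        rw [rval_leave_simOwner, rval_sim_pureProfile]
    | start => exact absurd (Option.some_inj.1 ho').symm hp1
    | instr => exact absurd (Option.some_inj.1 ho').symm hp0
    | ctl => exact absurd (Option.some_inj.1 ho').symm hp0
    | _ => cases ho'
  intro p
  by_cases hp : p = .zero ∨ p = .one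
  · exact isBestResponse_of_payoff_eq_one (payoff_pureProfile hp)
  · exact hsim p (fun h => hp (Or.inl h)) (fun h => hp (Or.inr h))

end Equilibrium

end CounterMachine

theorem mainTheorem7 :
    (∃ σ : CounterMachine.incMachine.game.Profile,
      SSMG.IsPureProfile σ ∧ SSMG.IsNash σ .start ∧ SSMG.payoff σ .start .zero = 1) ∧
    ¬ ∃ σ : CounterMachine.incMachine.game.Profile,
      SSMG.IsFiniteStateProfile σ ∧ SSMG.IsNash σ .start ∧ 0 < SSMG.payoff σ .start .zero :=
  ⟨⟨CounterMachine.pureProfile, CounterMachine.isPure_pureProfile,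
    CounterMachine.isNash_pureProfile, CounterMachine.payoff_pureProfile (Or.inl rfl)⟩,
    CounterMachine.not_exists_finiteState⟩
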